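/- Let $\mathcal E$ be a locally small cocomplete (elementary) topos. A point of $\mathcal E$ is a geometric morphism $p:\mathbf{Set}\to\mathcal E$, with inverse image $p^*:\mathcal E\to\mathbf{Set}$; points are considered up to isomorphism (of inverse image functors). Let $P$ be a set of points of $\mathcal E$ which separates the subterminals of $\mathcal E$: whenever $u,w$ are non-isomorphic subobjects of the terminal object $1_{\mathcal E}$, there is $p\in P$ such that $p^*(u)\not\cong p^*(w)$. Let $X$ be the set $P$ equipped with the subterminal topology, whose open sets are exactly the sets $\{p\in P \mid p^*(u)\cong 1_{\mathbf{Set}}\}$ for $u$ a subobject of $1_{\mathcal E}$. (i) Let $\mathcal E\xrightarrow{h}\mathcal F\xrightarrow{l}\mathbf{Set}$ be the hyperconnected–localic factorization of the (up to isomorphism) unique geometric morphism $\mathcal E\to\mathbf{Set}$; that is, $\mathcal F$ is a locally small topos, $l\circ h$ is isomorphic to that geometric morphism, $h$ is hyperconnected ($h^*$ is full and faithful and its essential image is closed under subobjects and quotients in $\mathcal E$), and $l$ is localic (every object of $\mathcal F$ is a quotient of a subobject of $l^*(S)$ for some set $S$). Then $X$ is sober if and only if the map $s\mapsto h\circ s$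 from $P$ to the collection of all points of $\mathcal F$ is a bijection. (ii) In particular, if $\mathcal E$ is localic (that is, the geometric morphism $\mathcal E\to\mathbf{Set}$ is localic), then $X$ is sober if and only if $P$ is the collection of all points of $\mathcal E$. -/

import Mathlib

open CategoryTheory CategoryTheory.Limits

universe v v₁ v₂ v₃ u u₁ u₂ u₃

namespace SubterminalSobriety

/-- An (elementary) topos: a category with finite limits, exponentials and a subobject
classifier. -/
class IsTopos (E : Type u) [Category.{v} E] : Prop
    extends HasFiniteLimits E, HasSubobjectClassifier E where
  exponentiable : ∀ A : E, (prod.functor.obj A).IsLeftAdjoint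

/-- A geometric morphism `E → F`: an adjunction `f^* ⊣ f_*` with `f_* : E ⥤ F` (direct image) and
`f^* : F ⥤ E` (inverse image) such that `f^*` preserves finite limits. -/
structure GeomMorphism (E : Type u₁) [Category.{v₁} E] (F : Type u₂) [Category.{v₂} F] where
  direct : E ⥤ F
  inverse : F ⥤ E
  adj : inverse ⊣ direct
  lex : PreservesFiniteLimits inverse

namespace GeomMorphism

section

variable {E : Type u₁} [Category.{v₁} E] {F : Type u₂} [Category.{v₂} F]
  {G : Type u₃} [Category.{v₃} G]

/-- The composite `E → F → G` of geometric morphisms, in diagrammatic order. -/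
def comp (f : GeomMorphism E F) (g : GeomMorphism F G) : GeomMorphism E G where
  direct := f.direct ⋙ g.direct
  inverse := g.inverse ⋙ f.inverse
  adj := g.adj.comp f.adj
  lex := by
    have := f.lex
    have := g.lex
    exact comp_preservesFiniteLimits _ _

/-- Two geometric morphisms are isomorphic when their inverse images are naturally isomorphic. -/
instance isoSetoid (E : Type u₁) [Category.{v₁} E] (F : Type u₂) [Category.{v₂} F] :
    Setoid (GeomMorphism E F) where
  r f g := Nonempty (f.inverse ≅ g.inverse)
  iseqv :=
    { refl := fun _ => ⟨Iso.refl _⟩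
      symm := fun ⟨e⟩ => ⟨e.symm⟩
      trans := fun ⟨e⟩ ⟨e'⟩ => ⟨e ≪≫ e'⟩ }

/-- `f : E → F` is localic: every object of `E` is a subquotient of (a quotient of a subobject of)
an object of the form `f^* S`. -/
def IsLocalic (f : GeomMorphism E F) : Prop :=
  ∀ A : E, ∃ (S : F) (B : E) (m : B ⟶ f.inverse.obj S) (e : B ⟶ A), Mono m ∧ Epi e

/-- `f : E → F` is hyperconnected: `f^*` is full and faithful, and its essential image is closed
under subobjects and quotients in `E`. -/
structure IsHyperconnected (f : GeomMorphism E F) : Prop where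
  full : f.inverse.Full
  faithful : f.inverse.Faithful
  closed_sub : f.inverse.essImage.IsClosedUnderSubobjects
  closed_quot : f.inverse.essImage.IsClosedUnderQuotients

end

end GeomMorphism

/-- The points of a topos `E` with hom-sets in `Type v`: isomorphism classes of geometric
morphisms `Set → E`, where `Set` is `Type v`. -/
abbrev Point (E : Type u) [Category.{v} E] : Type (max u (v + 1)) :=
  Quotient (GeomMorphism.isoSetoid (Type v) E)

/-- The action `s ↦ f ∘ s` of a geometric morphism `f : E → F` on points. -/
def Point.map {E : Type u₁} [Category.{v} E] {F : Type u₂} [Category.{v} F]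
    (f : GeomMorphism E F) : Point E → Point F :=
  Quotient.map (fun s => s.comp f) (fun _ _ (h : Nonempty _) => h.elim fun e => ⟨Functor.isoWhiskerLeft f.inverse e⟩)

/-- A locally small topos is localic when it admits a localic geometric morphism to `Set`
(the geometric morphism to `Set` being unique up to isomorphism). -/
def IsLocalicTopos (E : Type u) [Category.{v} E] : Prop :=
  ∃ γ : GeomMorphism E (Type v), γ.IsLocalic

section Subterminals

variable {E : Type u} [Category.{v} E]

/-- `p^* A ≅ 1` in `Set`, for a point `p` and an object `A`. -/
def Point.Inhabits (p : Point E) (A : E) : Prop :=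
  Quotient.lift (fun f : GeomMorphism (Type v) E => Nonempty (f.inverse.obj A ≅ PUnit.{v + 1}))
    (fun _ _ (h : Nonempty _) => h.elim fun e => propext
      ⟨fun ⟨i⟩ => ⟨(e.app A).symm ≪≫ i⟩, fun ⟨i⟩ => ⟨e.app A ≪≫ i⟩⟩) p

/-- The set of points `P` separates the subterminals of `E`: for any non-isomorphic subterminals
`u`, `w` there is a point `f` in `P` such that `f^* u` and `f^* w` are not isomorphic. -/
def SeparatesSubterminals [HasTerminal E] (P : Set (Point E)) : Prop :=
  ∀ u w : Subobject (⊤_ E), IsEmpty ((u : E) ≅ (w : E)) →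
    ∃ f : GeomMorphism (Type v) E, (⟦f⟧ : Point E) ∈ P ∧
      IsEmpty (f.inverse.obj (u : E) ≅ f.inverse.obj (w : E))

/-- The map `φ` from subterminals to subsets of `P`, `φ u = {p ∈ P | p^* u ≅ 1}`. -/
def openOf [HasTerminal E] (P : Set (Point E)) (u : Subobject (⊤_ E)) : Set P :=
  {p | p.1.Inhabits (u : E)}

end Subterminals

/-! Facts needed to see that the sets `φ u` form a topology. -/

section Facts

variable {E : Type u} [Category.{v} E]

theorem small_subobject [HasFiniteLimits E] [HasSubobjectClassifier E] (X : E) :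
    Small.{v} (Subobject X) := by
  obtain ⟨⟨c⟩⟩ := (inferInstance : HasSubobjectClassifier E)
  exact small_of_injective c.representableBy.homEquiv.symm.injective

theorem hasImages [HasFiniteLimits E] [HasSubobjectClassifier E] [HasColimits E] :
    HasImages E := by
  refine ⟨fun {X Y} g => ⟨⟨⟨{
    I := equalizer (pushout.inl g g) (pushout.inr g g)
    m := equalizer.ι _ _
    e := equalizer.lift g pushout.condition
    fac := equalizer.lift_ι _ _ }, ⟨fun F' => ?_, fun F' => ?_⟩⟩⟩⟩⟩
  all_goals
    have r : RegularMono F'.m := regularMonoOfMono F'.m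
  · refine (Fork.IsLimit.lift' r.isLimit
      (equalizer.ι (pushout.inl g g) (pushout.inr g g)) ?_).1
    have h : g ≫ r.left = g ≫ r.right := by
      simpa using F'.e ≫= r.w
    have := equalizer.condition (pushout.inl g g) (pushout.inr g g) =≫ pushout.desc _ _ h
    simpa only [Category.assoc, pushout.inl_desc, pushout.inr_desc] using this
  · exact (Fork.IsLimit.lift' _ _ _).2

theorem exists_isLUB [HasFiniteLimits E] [HasSubobjectClassifier E] [HasColimits E] {X : E}
    (s : Set (Subobject X)) : ∃ u, IsLUB s u := by
  have : WellPowered.{v} E := ⟨small_subobject⟩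
  have : HasImages E := hasImages
  exact ⟨Subobject.sSup.{v} s, Subobject.le_sSup.{v} s, Subobject.sSup_le.{v} s⟩

variable (f : GeomMorphism (Type v) E)

theorem inhabits_mk_iff (A : E) :
    Point.Inhabits (⟦f⟧ : Point E) A ↔ Nonempty (f.inverse.obj A ≅ PUnit.{v + 1}) :=
  Iff.rfl

theorem inhabits_iff_nonempty [HasFiniteLimits E] (u : Subobject (⊤_ E)) :
    Point.Inhabits (⟦f⟧ : Point E) (u : E) ↔ Nonempty (f.inverse.obj (u : E)) := by
  rw [inhabits_mk_iff]
  have := f.lex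
  constructor
  · rintro ⟨i⟩
    exact ⟨i.inv PUnit.unit⟩
  · rintro ⟨a⟩
    have hT : IsTerminal (f.inverse.obj (⊤_ E)) := IsTerminal.isTerminalObj _ _ terminalIsTerminal
    have hm : Mono (f.inverse.map u.arrow) := inferInstance
    have hsub : ∀ x y : f.inverse.obj (u : E), x = y := fun x y => by
      refine (mono_iff_injective _).1 hm ?_
      exact ConcreteCategory.congr_hom (hT.hom_ext
        (↾(fun _ : PUnit.{v + 1} => f.inverse.map u.arrow x))
        (↾(fun _ : PUnit.{v + 1} => f.inverse.map u.arrow y))) PUnit.unit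
    exact ⟨Equiv.toIso ⟨fun _ => PUnit.unit, fun _ => a, fun _ => hsub _ _, fun _ => rfl⟩⟩

theorem openOf_top [HasFiniteLimits E] (P : Set (Point E)) : openOf P ⊤ = Set.univ := by
  refine Set.eq_univ_of_forall ?_
  rintro ⟨p, hp⟩
  induction p using Quotient.inductionOn with | h f => ?_
  have := f.lex
  have hT : IsTerminal (f.inverse.obj (⊤_ E)) := IsTerminal.isTerminalObj _ _ terminalIsTerminal
  refine (inhabits_iff_nonempty f _).2 ⟨f.inverse.map (inv (⊤ : Subobject (⊤_ E)).arrow) ?_⟩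
  exact hT.from PUnit.{v + 1} PUnit.unit

theorem openOf_mono [HasFiniteLimits E] (P : Set (Point E)) {u w : Subobject (⊤_ E)} (h : u ≤ w) :
    openOf P u ⊆ openOf P w := by
  rintro ⟨p, hp⟩
  induction p using Quotient.inductionOn with | h f => ?_
  intro hx
  obtain ⟨a⟩ := (inhabits_iff_nonempty f _).1 hx
  exact (inhabits_iff_nonempty f _).2 ⟨f.inverse.map (u.ofLE w h) a⟩

theorem openOf_inf [HasFiniteLimits E] (P : Set (Point E)) (u w : Subobject (⊤_ E)) :
    openOf P (u ⊓ w) = openOf P u ∩ openOf P w := by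
  refine Set.Subset.antisymm
    (Set.subset_inter (openOf_mono P inf_le_left) (openOf_mono P inf_le_right)) ?_
  rintro ⟨p, hp⟩
  induction p using Quotient.inductionOn with | h f => ?_
  rintro ⟨hu, hw⟩
  obtain ⟨a⟩ := (inhabits_iff_nonempty f _).1 hu
  obtain ⟨b⟩ := (inhabits_iff_nonempty f _).1 hw
  have := f.lex
  have hmono : Mono (terminal.from ((u : E) ⨯ (w : E))) := ⟨fun x y _ => by
    apply Limits.prod.hom_ext
    · exact (cancel_mono u.arrow).1 (Subsingleton.elim _ _)
    · exact (cancel_mono w.arrow).1 (Subsingleton.elim _ _)⟩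
  have hle : Subobject.mk (terminal.from ((u : E) ⨯ (w : E))) ≤ u ⊓ w :=
    le_inf (Subobject.mk_le_of_comm Limits.prod.fst (Subsingleton.elim _ _))
      (Subobject.mk_le_of_comm Limits.prod.snd (Subsingleton.elim _ _))
  refine (inhabits_iff_nonempty f _).2
    ⟨f.inverse.map ((Subobject.underlyingIso _).inv ≫ Subobject.ofLE _ _ hle) ?_⟩
  exact (PreservesLimitPair.iso f.inverse (u : E) (w : E)).inv
    (Limits.prod.lift (↾(fun _ : PUnit.{v + 1} => a)) (↾(fun _ : PUnit.{v + 1} => b)) PUnit.unit)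

theorem openOf_isLUB [HasFiniteLimits E] (P : Set (Point E)) {s : Set (Subobject (⊤_ E))}
    {u : Subobject (⊤_ E)} (h : IsLUB s u) : openOf P u = ⋃ w ∈ s, openOf P w := by
  refine Set.Subset.antisymm ?_ (Set.iUnion₂_subset fun w hw => openOf_mono P (h.1 hw))
  rintro ⟨p, hp⟩
  induction p using Quotient.inductionOn with | h f => ?_
  intro hu
  by_contra hcon
  have hempty : ∀ w ∈ s, f.inverse.obj (w : E) → False := fun w hw a =>
    hcon (Set.mem_iUnion₂.2 ⟨w, hw, (inhabits_iff_nonempty f _).2 ⟨a⟩⟩)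
  have hmono : Mono (terminal.from (f.direct.obj PEmpty.{v + 1})) := ⟨fun x y _ => by
    apply (f.adj.homEquiv _ _).symm.injective
    ext a
    exact (((f.adj.homEquiv _ _).symm x) a).elim⟩
  have hub : u ≤ Subobject.mk (terminal.from (f.direct.obj PEmpty.{v + 1})) :=
    h.2 fun w hw => Subobject.le_mk_of_comm
      (f.adj.homEquiv _ _ (↾(fun a => (hempty w hw a).elim))) (Subsingleton.elim _ _)
  obtain ⟨a⟩ := (inhabits_iff_nonempty f _).1 hu
  exact ((f.adj.homEquiv _ _).symm
    (Subobject.ofLE _ _ hub ≫ (Subobject.underlyingIso _).hom) a).elim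

end Facts

/-- The space of the points in `P`, with underlying set `P`. -/
def SubterminalSpace {E : Type u} [Category.{v} E] (P : Set (Point E)) : Type (max u (v + 1)) :=
  P

/-- The subterminal topology on `P`: the open sets are exactly the sets `φ u`, for `u` a
subterminal of `E`. -/
instance subterminalTopology {E : Type u} [Category.{v} E] [HasFiniteLimits E]
    [HasSubobjectClassifier E] [HasColimits E] (P : Set (Point E)) :
    TopologicalSpace (SubterminalSpace P) where
  IsOpen U := ∃ u : Subobject (⊤_ E), U = openOf P u
  isOpen_univ := ⟨⊤, (openOf_top P).symm⟩
  isOpen_inter := by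
    rintro _ _ ⟨u, rfl⟩ ⟨w, rfl⟩
    exact ⟨u ⊓ w, (openOf_inf P u w).symm⟩
  isOpen_sUnion := by
    intro S hS
    obtain ⟨u, hu⟩ := exists_isLUB {w : Subobject (⊤_ E) | (openOf P w : Set P) ∈ S}
    refine ⟨u, ?_⟩
    rw [openOf_isLUB P hu]
    ext x
    constructor
    · rintro ⟨U, hU, hx⟩
      obtain ⟨w, rfl⟩ := hS U hU
      exact Set.mem_iUnion₂.2 ⟨w, hU, hx⟩
    · intro hx
      obtain ⟨w, hw, hx⟩ := Set.mem_iUnion₂.1 hx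
      exact ⟨_, hw, hx⟩

/-- A space is sober when every irreducible closed subset is the closure of exactly one point:
existence is `QuasiSober`, uniqueness is `T0Space`. -/
def IsSober (X : Type u) [TopologicalSpace X] : Prop :=
  QuasiSober X ∧ T0Space X

end SubterminalSobriety

/-!
# Sobriety of the subterminal topology

The subterminals of a topos form a frame, and a point inhabits exactly the subterminals that are
not below a certain prime one, the largest subterminal that it does not inhabit
(`GeomMorphism.isGeneric_direct_pempty`, `GeomMorphism.isPrimeSubterminal_direct_pempty`). When the
points in `P` separate subterminals, the open sets of the space `X` of points in `P` form the same
frame, so the irreducible closed sets of `X` correspond to the prime subterminals. Thus `X` is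
quasi-sober when each prime subterminal comes from a point in `P` (`quasiSober_iff`), and it is
`T0` when the points in `P` are distinguished by the subterminals that they inhabit
(`inseparable_iff`).

A hyperconnected morphism `h : E → F` identifies the subterminals of `E` with those of `F`
(`GeomMorphism.IsHyperconnected.exists_iso`), and its inverse image makes `F` a coreflective
subcategory of `E`, so `F` is cocomplete. It remains to see that the points of the localic topos `F`
correspond to its prime subterminals. That a point is determined by the subterminals it inhabits
(`equiv_of_inhabits_iff`) holds because subterminals separate the morphisms of `F`, so that elements
of `f^* A` are germs of morphisms `U ⟶ A` from subterminals.

Conversely, the point associated with a prime `V` has inverse image the stalk functor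
`A ↦ colim Hom(U, A)`, over the subterminals `U` not below `V`; it preserves finite limits since the
colimit is filtered. Its right adjoint takes a set `S` to the skyscraper, which is explicitly the
union of `S` copies of the terminal object glued along `V`. Morphisms from a subterminal `U` to the
skyscraper are the elements of `S` if `U` is not below `V` (`skyscraper.exists_eq_ι`), and there is
just one otherwise (`skyscraper.eq_head`). A map `stalk A → S` hence prescribes a compatible family
of morphisms from subterminals over `A` to the skyscraper, and these glue to a morphism on `A`
(`exists_glue`). The exactness needed for the skyscraper and the gluing is the stability of jointly
epimorphic families under pullback along monomorphisms (`JointlyEpi.pullback_snd`), which follows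
from the subobject classifier and suffices because every morphism from a subterminal is monic.
-/

namespace SubterminalSobriety

/-! ### Jointly epimorphic families -/

section Covers

variable {C : Type u} [Category.{v} C]

/-- A family of morphisms with common codomain `A` is jointly epimorphic when a morphism out of
`A` is determined by its composites with the members of the family. -/
def JointlyEpi {ι : Type*} {X : ι → C} {A : C} (e : ∀ i, X i ⟶ A) : Prop :=
  ∀ ⦃Z : C⦄ (g h : A ⟶ Z), (∀ i, e i ≫ g = e i ≫ h) → g = h

namespace JointlyEpi

variable {ι : Type*} {X : ι → C} {A : C} {e : ∀ i, X i ⟶ A}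

/-- Subobjects are classified by morphisms to `Ω`, so they can be compared along a jointly
epimorphic family. -/
theorem subobject_ext [HasPullbacks C] [HasSubobjectClassifier C] (he : JointlyEpi e)
    {M N : Subobject A}
    (h : ∀ i, (Subobject.pullback (e i)).obj M = (Subobject.pullback (e i)).obj N) : M = N := by
  obtain ⟨⟨c⟩⟩ := (inferInstance : HasSubobjectClassifier C)
  obtain ⟨φ, rfl⟩ := c.representableBy.homEquiv.surjective M
  obtain ⟨ψ, rfl⟩ := c.representableBy.homEquiv.surjective N
  refine congrArg _ (he _ _ fun i => c.representableBy.homEquiv.injective ?_)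
  rw [c.representableBy.homEquiv_comp, c.representableBy.homEquiv_comp]
  exact h i

/-- In the presence of a subobject classifier, jointly epimorphic families are stable under
pullback along monomorphisms. -/
theorem pullback_snd [HasPullbacks C] [HasEqualizers C] [HasSubobjectClassifier C]
    (he : JointlyEpi e) {B : C} (m : B ⟶ A) [Mono m] :
    JointlyEpi fun i => pullback.snd (e i) m := by
  intro Z g h hgh
  -- The equalizer of `g` and `h` and `B` itself have the same inverse images along the `e i`.
  have key : Subobject.mk m = Subobject.mk (equalizer.ι g h ≫ m) := by
    refine he.subobject_ext fun i => ?_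
    rw [Subobject.pullback_obj_mk (IsPullback.of_hasPullback (e i) m).flip,
      Subobject.pullback_obj_mk (IsPullback.of_hasPullback (e i) (equalizer.ι g h ≫ m)).flip]
    refine le_antisymm (Subobject.mk_le_mk_of_comm
      (pullback.lift (pullback.fst _ _) (equalizer.lift (pullback.snd _ _) (hgh i)) ?_) ?_)
      (Subobject.mk_le_mk_of_comm
        (pullback.lift (pullback.fst _ _) (pullback.snd _ _ ≫ equalizer.ι g h) ?_) ?_)
    · rw [equalizer.lift_ι_assoc, pullback.condition]
    · exact pullback.lift_fst _ _ _
    · rw [pullback.condition, Category.assoc]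
    · exact pullback.lift_fst _ _ _
  have hk' : Subobject.ofMkLEMk _ _ key.le ≫ equalizer.ι g h = 𝟙 B := by
    rw [← cancel_mono m, Category.assoc, Subobject.ofMkLEMk_comp, Category.id_comp]
  rw [← Category.id_comp g, ← Category.id_comp h, ← hk', Category.assoc, Category.assoc,
    equalizer.condition]

theorem isIso_of_factors [HasSubobjectClassifier C] (he : JointlyEpi e) {M : C} (m : M ⟶ A)
    [Mono m] (k : ∀ i, X i ⟶ M) (hk : ∀ i, k i ≫ m = e i) : IsIso m := by
  have : Epi m := ⟨fun g h hgh => he _ _ fun i => by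
    rw [← hk i, Category.assoc, Category.assoc, hgh]⟩
  exact isIso_of_mono_of_epi m

end JointlyEpi

end Covers

/-! ### Subterminal objects -/

section IsSubterminal

variable {C : Type u} [Category.{v} C] {D : Type u₁} [Category.{v₁} D]

theorem isSubterminal_of_mono {U W : C} (hW : IsSubterminal W) (m : U ⟶ W) [Mono m] :
    IsSubterminal U :=
  fun _ f g => (cancel_mono m).1 (hW (f ≫ m) (g ≫ m))

theorem mono_of_isSubterminal {U A : C} (hU : IsSubterminal U) (a : U ⟶ A) : Mono a :=
  ⟨fun _ _ _ => hU _ _⟩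

theorem isSubterminal_subobject [HasTerminal C] (u : Subobject (⊤_ C)) : IsSubterminal (u : C) :=
  isSubterminal_of_mono isSubterminal_of_terminal u.arrow

theorem isSubterminal_prod [HasBinaryProducts C] {U W : C} (hU : IsSubterminal U)
    (hW : IsSubterminal W) : IsSubterminal (U ⨯ W) :=
  fun _ _ _ => Limits.prod.hom_ext (hU _ _) (hW _ _)

theorem isSubterminal_obj [HasTerminal C] (G : C ⥤ D) [PreservesFiniteLimits G] {U : C}
    (hU : IsSubterminal U) : IsSubterminal (G.obj U) := by
  have := hU.mono_terminal_from
  exact isSubterminal_of_mono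
    (isSubterminal_of_isTerminal (terminalIsTerminal.isTerminalObj G)) (G.map (terminal.from U))

theorem isSubterminal_type_iff {X : Type v} : IsSubterminal X ↔ Subsingleton X := by
  refine ⟨fun h => ⟨fun x y => ?_⟩, fun h Z f g => by ext z; exact h.elim _ _⟩
  exact ConcreteCategory.congr_hom (h (↾fun _ : PUnit.{v + 1} => x) (↾fun _ => y)) PUnit.unit

theorem GeomMorphism.subsingleton_obj [HasTerminal C] (f : GeomMorphism (Type v₁) C) {U : C}
    (hU : IsSubterminal U) : Subsingleton (f.inverse.obj U) := by
  have := f.lex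
  exact isSubterminal_type_iff.1 (isSubterminal_obj f.inverse hU)

end IsSubterminal

/-! ### Localic toposes and their points -/

section Localic

variable {C : Type u} [Category.{v} C]

/-- When subterminals separate, the elements of the fibre `f^* A` at a point are germs of
morphisms `U ⟶ A` from subterminals `U` inhabited by the point. -/
theorem exists_germ (hsep : ObjectProperty.IsSeparating (fun U : C => IsSubterminal U))
    (f : GeomMorphism (Type v) C) {A : C} (y : f.inverse.obj A) :
    ∃ (U : C) (_ : IsSubterminal U) (a : U ⟶ A) (t : f.inverse.obj U), f.inverse.map a t = y := by
  by_contra! hcon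
  -- Otherwise the constant map `True` on `f^* A` and the map `(· ≠ y)` agree on all germs.
  let p : f.inverse.obj A ⟶ ULift.{v} Prop := ↾fun _ => ⟨True⟩
  let q : f.inverse.obj A ⟶ ULift.{v} Prop := ↾fun z => ⟨z ≠ y⟩
  have hpq : f.adj.homEquiv _ _ p = f.adj.homEquiv _ _ q := by
    refine hsep _ _ fun U hU a => ?_
    rw [← f.adj.homEquiv_naturality_left, ← f.adj.homEquiv_naturality_left]
    congr 1
    ext t
    exact iff_of_true trivial (hcon U hU a t)
  have := ConcreteCategory.congr_hom ((f.adj.homEquiv _ _).injective hpq) y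
  exact (cast (congrArg ULift.down this) trivial : y ≠ y) rfl

variable [HasFiniteLimits C]

/-- In a localic topos the subterminal objects separate morphisms: the elements of a set `S` cover
`l^* S`, hence subterminals cover every subobject of `l^* S` and every quotient of such. -/
theorem GeomMorphism.IsLocalic.isSeparating [HasSubobjectClassifier C]
    {l : GeomMorphism C (Type v)} (hl : l.IsLocalic) :
    ObjectProperty.IsSeparating (fun U : C => IsSubterminal U) := by
  intro A Y f g hfg
  obtain ⟨S, B, m, e, hm, he⟩ := hl A
  have hS : JointlyEpi fun s : S => l.inverse.map (↾fun _ : PUnit.{v + 1} => s) := by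
    intro Z a b hab
    apply (l.adj.homEquiv _ _).injective
    ext s
    have := congrArg (l.adj.homEquiv _ _) (hab s)
    rw [l.adj.homEquiv_naturality_left, l.adj.homEquiv_naturality_left] at this
    exact ConcreteCategory.congr_hom this PUnit.unit
  have := l.lex
  have h1 : IsSubterminal (l.inverse.obj PUnit.{v + 1}) :=
    isSubterminal_obj l.inverse (isSubterminal_type_iff.2 inferInstance)
  rw [← cancel_epi e]
  refine hS.pullback_snd m _ _ fun s => ?_
  rw [← Category.assoc, ← Category.assoc]
  exact hfg _ (isSubterminal_of_mono h1 (pullback.fst _ _)) _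

/-- Two morphisms from subterminals with the same germ at `f` agree on an inhabited subterminal;
hence they have the same germ at any point inhabiting the same subterminals. -/
theorem germ_eq_of_inhabits {f g : GeomMorphism (Type v) C}
    (hfg : ∀ U : C, IsSubterminal U → Nonempty (f.inverse.obj U) → Nonempty (g.inverse.obj U))
    {A U W : C} (hU : IsSubterminal U) (hW : IsSubterminal W) (a : U ⟶ A) (b : W ⟶ A)
    {t : f.inverse.obj U} {s : f.inverse.obj W} (h : f.inverse.map a t = f.inverse.map b s)
    (t' : g.inverse.obj U) (s' : g.inverse.obj W) : g.inverse.map a t' = g.inverse.map b s' := by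
  have := f.lex
  have := mono_of_isSubterminal hW b
  obtain ⟨r, -, -⟩ := Types.exists_of_isPullback
    ((IsPullback.of_hasPullback a b).map f.inverse) t s h
  obtain ⟨r'⟩ := hfg _ (isSubterminal_of_mono hU (pullback.fst a b)) ⟨r⟩
  have hU' := g.subsingleton_obj hU
  have hW' := g.subsingleton_obj hW
  rw [Subsingleton.elim t' (g.inverse.map (pullback.fst a b) r'),
    Subsingleton.elim s' (g.inverse.map (pullback.snd a b) r')]
  have := ConcreteCategory.congr_hom
    (congrArg g.inverse.map (pullback.condition (f := a) (g := b))) r'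
  simpa using this

/-- When subterminals separate, a point is determined by the subterminals that it inhabits. -/
theorem equiv_of_inhabits_iff
    (hsep : ObjectProperty.IsSeparating (fun U : C => IsSubterminal U))
    {f g : GeomMorphism (Type v) C}
    (hfg : ∀ U : C, IsSubterminal U → (Nonempty (f.inverse.obj U) ↔ Nonempty (g.inverse.obj U))) :
    f ≈ g := by
  have transfer : ∀ {f g : GeomMorphism (Type v) C}, (∀ U : C, IsSubterminal U →
      (Nonempty (f.inverse.obj U) ↔ Nonempty (g.inverse.obj U))) → ∀ (A : C) (y : f.inverse.obj A),
      ∃ z : g.inverse.obj A, ∀ (U : C) (_ : IsSubterminal U) (a : U ⟶ A) (t : f.inverse.obj U)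
        (t' : g.inverse.obj U), f.inverse.map a t = y → g.inverse.map a t' = z := by
    intro f g hfg A y
    obtain ⟨U, hU, a, t, rfl⟩ := exists_germ hsep f y
    obtain ⟨t'⟩ := (hfg U hU).1 ⟨t⟩
    exact ⟨g.inverse.map a t', fun W hW b s s' h =>
      germ_eq_of_inhabits (fun U hU => (hfg U hU).1) hW hU b a h s' t'⟩
  choose φ hφ using transfer hfg
  choose ψ hψ using transfer fun U hU => (hfg U hU).symm
  have hψφ : ∀ A y, ψ A (φ A y) = y := by
    intro A y
    obtain ⟨U, hU, a, t, rfl⟩ := exists_germ hsep f y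
    obtain ⟨t'⟩ := (hfg U hU).1 ⟨t⟩
    exact (hψ A _ U hU a t' t (hφ A _ U hU a t t' rfl)).symm
  have hφψ : ∀ A z, φ A (ψ A z) = z := by
    intro A y
    obtain ⟨U, hU, a, t, rfl⟩ := exists_germ hsep g y
    obtain ⟨t'⟩ := (hfg U hU).2 ⟨t⟩
    exact (hφ A _ U hU a t' t (hψ A _ U hU a t t' rfl)).symm
  refine ⟨NatIso.ofComponents
    (fun A => Equiv.toIso ⟨φ A, ψ A, hψφ A, hφψ A⟩) fun {A B} k => ?_⟩
  ext y
  obtain ⟨U, hU, a, t, rfl⟩ := exists_germ hsep f y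
  obtain ⟨t'⟩ := (hfg U hU).1 ⟨t⟩
  have h1 := hφ A _ U hU a t t' rfl
  have h2 := hφ B _ U hU (a ≫ k) t t' rfl
  simp only [Functor.map_comp, types_comp_apply] at h2
  change φ B (f.inverse.map k (f.inverse.map a t)) = g.inverse.map k (φ A (f.inverse.map a t))
  rw [← h1]
  exact h2.symm

end Localic

/-! ### Gluing morphisms defined on subterminals -/

section Glue

variable {C : Type u} [Category.{v} C] [HasFiniteLimits C] [HasSubobjectClassifier C]

/-- When subterminals separate, a compatible family of morphisms `U ⟶ R`, one for each morphism
from a subterminal `U` to `A`, glues to a morphism `A ⟶ R`. Its graph is the union in `A ⨯ R` of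
the graphs of the given morphisms. -/
theorem exists_glue [HasColimits C]
    (hsep : ObjectProperty.IsSeparating (fun U : C => IsSubterminal U)) {A R : C}
    (r : ∀ U : C, IsSubterminal U → (U ⟶ A) → (U ⟶ R))
    (hr : ∀ (W U : C) (hW : IsSubterminal W) (hU : IsSubterminal U) (k : W ⟶ U) (a : U ⟶ A),
      k ≫ r U hU a = r W hW (k ≫ a)) :
    ∃ g : A ⟶ R, ∀ (U : C) (hU : IsSubterminal U) (a : U ⟶ A), a ≫ g = r U hU a := by
  obtain ⟨Γ, hΓ⟩ := exists_isLUB {M : Subobject (A ⨯ R) | ∃ (U : C) (hU : IsSubterminal U)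
    (a : U ⟶ A) (_ : Mono (prod.lift a (r U hU a))), M = Subobject.mk (prod.lift a (r U hU a))}
  have hfac : ∀ (U : C) (hU : IsSubterminal U) (a : U ⟶ A),
      ∃ k : U ⟶ (Γ : C), k ≫ Γ.arrow = prod.lift a (r U hU a) := by
    intro U hU a
    have := mono_of_isSubterminal hU (prod.lift a (r U hU a))
    have hle : Subobject.mk (prod.lift a (r U hU a)) ≤ Γ := hΓ.1 ⟨U, hU, a, this, rfl⟩
    exact ⟨(Subobject.underlyingIso _).inv ≫ Subobject.ofLE _ _ hle, by simp⟩
  choose k hk using hfac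
  have hcover : JointlyEpi fun i : Σ U : {U : C // IsSubterminal U}, (U.1 ⟶ A) =>
      k i.1.1 i.1.2 i.2 := by
    intro Z g h hgh
    have hle : Γ ≤ Subobject.mk (equalizer.ι g h ≫ Γ.arrow) := by
      refine hΓ.2 ?_
      rintro _ ⟨U, hU, a, hm, rfl⟩
      refine Subobject.mk_le_mk_of_comm (equalizer.lift _ (hgh ⟨⟨U, hU⟩, a⟩)) ?_
      rw [equalizer.lift_ι_assoc, hk]
    have hs : (Subobject.ofLE _ _ hle ≫ (Subobject.underlyingIso _).hom) ≫ equalizer.ι g h =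
        𝟙 _ := by
      rw [← cancel_mono Γ.arrow]
      simp
    rw [← Category.id_comp g, ← Category.id_comp h, ← hs, Category.assoc, Category.assoc _ _ h,
      equalizer.condition]
  -- On subterminals, `Γ` is the graph of `r`.
  have hgraph : ∀ (W : C) (hW : IsSubterminal W) (w : W ⟶ (Γ : C)),
      w ≫ Γ.arrow ≫ prod.snd = r W hW (w ≫ Γ.arrow ≫ prod.fst) := by
    intro W hW w
    have := mono_of_isSubterminal hW w
    refine hcover.pullback_snd w _ _ ?_
    rintro ⟨⟨U, hU⟩, a⟩
    have hP := isSubterminal_of_mono hU (pullback.fst (k U hU a) w)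
    dsimp only
    rw [hr _ W hP hW, ← pullback.condition_assoc, ← pullback.condition_assoc,
      ← Category.assoc _ _ prod.snd, ← Category.assoc _ _ prod.fst, hk, prod.lift_fst,
      prod.lift_snd, hr]
  have hmono : Mono (Γ.arrow ≫ (prod.fst : A ⨯ R ⟶ A)) := by
    refine ⟨fun {Z} s t hst => (cancel_mono Γ.arrow).1 (Limits.prod.hom_ext ?_ ?_)⟩
    · simpa using hst
    · refine hsep _ _ fun W hW w => ?_
      have h1 := hgraph W hW (w ≫ s)
      have h2 := hgraph W hW (w ≫ t)
      simp only [Category.assoc] at h1 h2 hst ⊢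
      rw [h1, h2, hst]
  have hcoverA : JointlyEpi fun i : Σ U : {U : C // IsSubterminal U}, (U.1 ⟶ A) => i.2 :=
    fun Z g h hgh => hsep _ _ fun U hU a => hgh ⟨⟨U, hU⟩, a⟩
  have hiso := hcoverA.isIso_of_factors (Γ.arrow ≫ prod.fst) (fun i => k i.1.1 i.1.2 i.2)
    fun i => by rw [← Category.assoc, hk, prod.lift_fst]
  refine ⟨inv (Γ.arrow ≫ (prod.fst : A ⨯ R ⟶ A)) ≫ Γ.arrow ≫ prod.snd, fun U hU a => ?_⟩
  have ha : a = k U hU a ≫ Γ.arrow ≫ prod.fst := by rw [← Category.assoc, hk, prod.lift_fst]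
  conv_lhs => rw [ha]
  rw [Category.assoc, IsIso.hom_inv_id_assoc, ← Category.assoc, hk, prod.lift_snd]

end Glue

/-! ### Stalks at a prime subterminal -/

section Stalk

variable {C : Type u} [Category.{v} C] [HasFiniteLimits C]

/-- A subterminal `V` is prime when, in the order of subterminals given by existence of morphisms,
it is a proper element such that `U ⊓ W ≤ V` implies `U ≤ V` or `W ≤ V`. The subterminals not below
`V` then form a completely prime filter. -/
structure IsPrimeSubterminal (V : C) : Prop where
  isSubterminal : IsSubterminal V
  isEmpty_top : IsEmpty (⊤_ C ⟶ V)
  le_or_le : ∀ U W : C, IsSubterminal U → IsSubterminal W → Nonempty (U ⨯ W ⟶ V) →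
    Nonempty (U ⟶ V) ∨ Nonempty (W ⟶ V)

variable [HasSubobjectClassifier C]

instance : Small.{v} (Subobject (⊤_ C)) := small_subobject _

/-- A small model of the subterminals that are not below `V`, the neighbourhoods of the point to be
associated with `V`. They are preordered by reverse inclusion. -/
def Nbhd (V : C) : Type v :=
  {i : Shrink.{v} (Subobject (⊤_ C)) //
    IsEmpty ((((equivShrink _).symm i : Subobject (⊤_ C)) : C) ⟶ V)}

namespace Nbhd

variable {V : C}

/-- The subterminal underlying a neighbourhood. -/
noncomputable def sub (i : Nbhd V) : Subobject (⊤_ C) := (equivShrink _).symm i.1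

theorem isEmpty_hom (i : Nbhd V) : IsEmpty ((i.sub : C) ⟶ V) := i.2

noncomputable instance : Preorder (Nbhd V) := Preorder.lift fun i => OrderDual.toDual i.sub

/-- The neighbourhood given by a subterminal object not below `V`. -/
noncomputable def mk {U : C} (hU : IsSubterminal U) (hUV : IsEmpty (U ⟶ V)) : Nbhd V :=
  have := hU.mono_terminal_from
  ⟨equivShrink _ (Subobject.mk (terminal.from U)), by
    rw [Equiv.symm_apply_apply]
    exact ⟨fun k => hUV.false ((Subobject.underlyingIso _).inv ≫ k)⟩⟩

/-- The underlying object of `Nbhd.mk` is the given one. -/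
noncomputable def mkIso {U : C} (hU : IsSubterminal U) (hUV : IsEmpty (U ⟶ V)) :
    ((mk hU hUV).sub : C) ≅ U :=
  have := hU.mono_terminal_from
  eqToIso (congrArg (fun M : Subobject (⊤_ C) => (M : C)) (Equiv.symm_apply_apply _ _)) ≪≫
    Subobject.underlyingIso (terminal.from U)

theorem le_of_hom {i j : Nbhd V} (k : (j.sub : C) ⟶ (i.sub : C)) : i ≤ j :=
  Subobject.le_of_comm (X := j.sub) (Y := i.sub) k (Subsingleton.elim _ _)

theorem isFiltered (hV : IsPrimeSubterminal V) : IsFiltered (Nbhd V) := by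
  have : Nonempty (Nbhd V) := ⟨mk isSubterminal_of_terminal hV.isEmpty_top⟩
  have : IsDirectedOrder (Nbhd V) := ⟨fun i j => by
    have hi := isSubterminal_subobject i.sub
    have hj := isSubterminal_subobject j.sub
    have hij : IsEmpty ((i.sub : C) ⨯ (j.sub : C) ⟶ V) := by
      by_contra! h
      rcases hV.le_or_le _ _ hi hj h with h | h
      · exact not_nonempty_iff.2 i.isEmpty_hom h
      · exact not_nonempty_iff.2 j.isEmpty_hom h
    exact ⟨mk (isSubterminal_prod hi hj) hij, le_of_hom ((mkIso _ _).hom ≫ prod.fst),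
      le_of_hom ((mkIso _ _).hom ≫ prod.snd)⟩⟩
  infer_instance

/-- The inclusion of a smaller neighbourhood in a larger one. -/
noncomputable def res {i j : Nbhd V} (h : i ≤ j) : (j.sub : C) ⟶ (i.sub : C) :=
  Subobject.ofLE j.sub i.sub h

variable (V) in
/-- The contravariant inclusion of the neighbourhoods. -/
noncomputable def functor : Nbhd V ⥤ Cᵒᵖ where
  obj i := Opposite.op (i.sub : C)
  map h := (res (leOfHom h)).op
  map_id _ := Quiver.Hom.unop_inj (isSubterminal_subobject _ _ _)
  map_comp _ _ := Quiver.Hom.unop_inj (isSubterminal_subobject _ _ _)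

end Nbhd

/-- The stalk functor `A ↦ colim Hom(U, A)`, the colimit being over the subterminals `U` that are
not below `V`. -/
noncomputable def stalk (V : C) : C ⥤ Type v := (Nbhd.functor V ⋙ coyoneda).flip ⋙ colim

theorem stalk_preservesFiniteLimits {V : C} (hV : IsPrimeSubterminal V) :
    PreservesFiniteLimits (stalk V) := by
  have := Nbhd.isFiltered hV
  have : PreservesFiniteLimits (Nbhd.functor V ⋙ coyoneda).flip :=
    preservesFiniteLimits_of_evaluation _ fun i =>
      inferInstanceAs (PreservesFiniteLimits (coyoneda.obj ((Nbhd.functor V).obj i)))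
  exact comp_preservesFiniteLimits _ _

variable {V : C}

/-- The germ of a morphism defined on a subterminal not below `V`. -/
noncomputable def germ {U A : C} (hU : IsSubterminal U) (hUV : IsEmpty (U ⟶ V)) (a : U ⟶ A) :
    (stalk V).obj A :=
  colimit.ι ((Nbhd.functor V ⋙ coyoneda).flip.obj A) (Nbhd.mk hU hUV)
    ((Nbhd.mkIso hU hUV).hom ≫ a : ((Nbhd.mk hU hUV).sub : C) ⟶ A)

theorem stalk_map_germ {U A B : C} (hU : IsSubterminal U) (hUV : IsEmpty (U ⟶ V)) (a : U ⟶ A)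
    (k : A ⟶ B) : (stalk V).map k (germ hU hUV a) = germ hU hUV (a ≫ k) := by
  have := ConcreteCategory.congr_hom
    (ι_colimMap ((Nbhd.functor V ⋙ coyoneda).flip.map k) (Nbhd.mk hU hUV))
    ((Nbhd.mkIso hU hUV).hom ≫ a : ((Nbhd.mk hU hUV).sub : C) ⟶ A)
  refine this.trans ?_
  change colimit.ι ((Nbhd.functor V ⋙ coyoneda).flip.obj B) (Nbhd.mk hU hUV)
    (((Nbhd.mkIso hU hUV).hom ≫ a) ≫ k : ((Nbhd.mk hU hUV).sub : C) ⟶ B) = _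
  rw [Category.assoc]
  rfl

theorem exists_eq_germ {A : C} (z : (stalk V).obj A) :
    ∃ (U : C) (hU : IsSubterminal U) (hUV : IsEmpty (U ⟶ V)) (a : U ⟶ A), z = germ hU hUV a := by
  obtain ⟨i, a, rfl⟩ := Types.jointly_surjective' z
  refine ⟨i.sub, isSubterminal_subobject _, i.isEmpty_hom, a, ?_⟩
  have hle : i ≤ Nbhd.mk (isSubterminal_subobject i.sub) i.isEmpty_hom :=
    Nbhd.le_of_hom (Nbhd.mkIso _ _).hom
  refine (ConcreteCategory.congr_hom
    (colimit.w ((Nbhd.functor V ⋙ coyoneda).flip.obj A) (homOfLE hle)) a).symm.trans ?_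
  refine congrArg (colimit.ι ((Nbhd.functor V ⋙ coyoneda).flip.obj A) _) ?_
  exact congrArg (· ≫ (a : (i.sub : C) ⟶ A)) (isSubterminal_subobject _ _ _)

theorem germ_comp {U W A : C} (hU : IsSubterminal U) (hUV : IsEmpty (U ⟶ V))
    (hW : IsSubterminal W) (hWV : IsEmpty (W ⟶ V)) (k : W ⟶ U) (a : U ⟶ A) :
    germ hW hWV (k ≫ a) = germ hU hUV a := by
  have hle : Nbhd.mk hU hUV ≤ Nbhd.mk hW hWV :=
    Nbhd.le_of_hom ((Nbhd.mkIso hW hWV).hom ≫ k ≫ (Nbhd.mkIso hU hUV).inv)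
  refine Eq.trans ?_ (ConcreteCategory.congr_hom
    (colimit.w ((Nbhd.functor V ⋙ coyoneda).flip.obj A) (homOfLE hle))
    ((Nbhd.mkIso hU hUV).hom ≫ a : ((Nbhd.mk hU hUV).sub : C) ⟶ A))
  refine congrArg (colimit.ι ((Nbhd.functor V ⋙ coyoneda).flip.obj A) _) ?_
  change _ = Nbhd.res hle ≫ (Nbhd.mkIso hU hUV).hom ≫ a
  rw [← Category.assoc, ← Category.assoc]
  exact congrArg (· ≫ a) (hU _ _)

theorem exists_of_germ_eq (hV : IsPrimeSubterminal V) {U W A : C} (hU : IsSubterminal U)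
    (hUV : IsEmpty (U ⟶ V)) (hW : IsSubterminal W) (hWV : IsEmpty (W ⟶ V)) {a : U ⟶ A} {b : W ⟶ A}
    (h : germ hU hUV a = germ hW hWV b) :
    ∃ (T : C) (_ : IsSubterminal T) (_ : IsEmpty (T ⟶ V)) (k : T ⟶ U) (l : T ⟶ W),
      k ≫ a = l ≫ b := by
  have := Nbhd.isFiltered hV
  obtain ⟨i, p, q, hpq⟩ := (Types.FilteredColimit.colimit_eq_iff _).1 h
  refine ⟨i.sub, isSubterminal_subobject _, i.isEmpty_hom,
    Nbhd.res (leOfHom p) ≫ (Nbhd.mkIso _ _).hom,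
    Nbhd.res (leOfHom q) ≫ (Nbhd.mkIso _ _).hom, ?_⟩
  rw [Category.assoc, Category.assoc]
  exact hpq

end Stalk

/-! ### Skyscrapers -/

section Skyscraper

variable {C : Type u} [Category.{v} C] [HasFiniteLimits C] [HasColimits C] (V : C)

/-- The skyscraper object with value the set `S`: the union of `S` copies of the terminal object,
glued together along `V`. -/
noncomputable def skyscraper (S : Type v) : C :=
  widePushout V (fun _ : S => ⊤_ C) fun _ => terminal.from V

namespace skyscraper

variable {S : Type v}

/-- The global element of the skyscraper given by an element of `S`. -/
noncomputable def ι (s : S) : ⊤_ C ⟶ skyscraper V S :=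
  WidePushout.ι (fun _ : S => terminal.from V) s

variable (S) in
/-- The inclusion of `V`, where all the elements of `S` agree. -/
noncomputable def head : V ⟶ skyscraper V S := WidePushout.head fun _ : S => terminal.from V

theorem from_comp_ι (s : S) : terminal.from V ≫ ι V s = head V S :=
  WidePushout.arrow_ι (fun _ : S => terminal.from V) s

variable {V}

theorem jointlyEpi : JointlyEpi (X := fun o : Option S => o.elim V fun _ => ⊤_ C)
    (A := skyscraper V S) (fun o => match o with | none => head V S | some s => ι V s) :=
  fun _ _ _ h => WidePushout.hom_ext _ _ _ (fun s => h (some s)) (h none)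

variable [HasSubobjectClassifier C]

/-- An equality of morphisms on a subterminal `U` may be checked where a given `r : U ⟶ R` to the
skyscraper is an element of `S` or factors through `V`. -/
theorem hom_ext_of_cover (hV : IsSubterminal V) {U Z : C} (hU : IsSubterminal U)
    (r : U ⟶ skyscraper V S) (g h : U ⟶ Z)
    (hs : ∀ (W : C) (_ : IsSubterminal W) (k : W ⟶ U) (s : S),
      k ≫ r = terminal.from W ≫ ι V s → k ≫ g = k ≫ h)
    (hn : ∀ (W : C) (_ : IsSubterminal W) (k : W ⟶ U) (j : W ⟶ V),
      k ≫ r = j ≫ head V S → k ≫ g = k ≫ h) : g = h := by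
  have := mono_of_isSubterminal hU r
  refine (jointlyEpi (V := V) (S := S)).pullback_snd r g h ?_
  rintro (_ | s)
  · have := mono_of_isSubterminal hV (head V S)
    refine hn _ (isSubterminal_of_mono hU (pullback.snd (head V S) r)) _
      (pullback.fst (head V S) r) pullback.condition.symm
  · refine hs _ (isSubterminal_of_mono isSubterminal_of_terminal (pullback.fst (ι V s) r)) _ s ?_
    rw [Subsingleton.elim (terminal.from _) (pullback.fst (ι V s) r)]
    exact pullback.condition.symm

theorem eq_head (hV : IsSubterminal V) {U : C} (hU : IsSubterminal U) (j : U ⟶ V)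
    (r : U ⟶ skyscraper V S) : r = j ≫ head V S := by
  refine hom_ext_of_cover hV hU r _ _ (fun W hW k s h => ?_) fun W hW k j' h => ?_
  · rw [h, ← from_comp_ι V s, ← Category.assoc, ← Category.assoc]
    exact congrArg (· ≫ ι V s) (Subsingleton.elim _ _)
  · rw [h, ← Category.assoc]
    exact congrArg (· ≫ head V S) (hV _ _)

/-- Distinct elements of `S` differ outside `V`: there is a morphism from the skyscraper to `Ω`
that takes the value `⊤` at `s` and `V` at all other elements. -/
theorem eq_or_le (hV : IsSubterminal V) {U : C} {s t : S}
    (h : terminal.from U ≫ ι V s = terminal.from U ≫ ι V t) : s = t ∨ Nonempty (U ⟶ V) := by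
  classical
  rw [or_iff_not_imp_left]
  intro hst
  obtain ⟨⟨c⟩⟩ := (inferInstance : HasSubobjectClassifier C)
  have := hV.mono_terminal_from
  have hp := c.isPullback (terminal.from V)
  let d : skyscraper V S ⟶ c.Ω := WidePushout.desc (c.χ₀ V ≫ c.truth)
    (fun x => if x = s then c.χ₀ _ ≫ c.truth else c.χ (terminal.from V)) fun x => by
      split_ifs
      · rw [← Category.assoc]
        exact congrArg (· ≫ c.truth) (Subsingleton.elim _ _)
      · exact hp.w
  have hd := congrArg (· ≫ d) h
  have hds : ι V s ≫ d = c.χ₀ _ ≫ c.truth := (WidePushout.ι_desc _ _ _ _ _).trans (if_pos rfl)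
  have hdt : ι V t ≫ d = c.χ (terminal.from V) :=
    (WidePushout.ι_desc _ _ _ _ _).trans (if_neg (Ne.symm hst))
  simp only [Category.assoc, hds, hdt] at hd
  rw [← Category.assoc] at hd
  exact ⟨hp.lift _ _ hd.symm⟩

/-- Outside `V`, a morphism from a subterminal to the skyscraper is an element of `S`. -/
theorem exists_eq_ι (hV : IsPrimeSubterminal V) {U : C} (hU : IsSubterminal U)
    (hUV : IsEmpty (U ⟶ V)) (r : U ⟶ skyscraper V S) :
    ∃ s : S, r = terminal.from U ≫ ι V s := by
  have hV' := hV.isSubterminal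
  -- If `r` were an element of `S` only below `V`, then `U` would be covered by `U ⨯ V`.
  obtain ⟨W, hW, k, s, hWV, hks⟩ : ∃ (W : C) (_ : IsSubterminal W) (k : W ⟶ U) (s : S),
      IsEmpty (W ⟶ V) ∧ k ≫ r = terminal.from W ≫ ι V s := by
    by_contra! hcon
    have hmono : Mono (prod.fst : U ⨯ V ⟶ U) :=
      mono_of_isSubterminal (isSubterminal_prod hU hV') _
    have hepi : Epi (prod.fst : U ⨯ V ⟶ U) := ⟨fun {Z} g h hgh => by
      have hj : ∀ (W : C) (k : W ⟶ U) (j : W ⟶ V), k ≫ g = k ≫ h := fun W k j => by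
        have := congrArg (prod.lift k j ≫ ·) hgh
        simpa only [prod.lift_fst_assoc] using this
      refine hom_ext_of_cover hV' hU r g h (fun W hW k s hks => ?_) fun W _ k j _ => hj W k j
      obtain ⟨j⟩ : Nonempty (W ⟶ V) := by
        by_contra hne
        exact hcon W hW k s (not_nonempty_iff.1 hne) hks
      exact hj W k j⟩
    have := isIso_of_mono_of_epi (prod.fst : U ⨯ V ⟶ U)
    exact hUV.false (inv (prod.fst : U ⨯ V ⟶ U) ≫ prod.snd)
  have hι : ∀ {W' : C} (k' : W' ⟶ U) (t : S),
      k' ≫ terminal.from U ≫ ι V t = terminal.from W' ≫ ι V t := fun k' t => by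
    rw [← Category.assoc]
    exact congrArg (· ≫ ι V t) (Subsingleton.elim _ _)
  refine ⟨s, hom_ext_of_cover hV' hU r _ _ (fun W' hW' k' t ht => ?_) fun W' hW' k' j _ =>
    (eq_head hV' hW' j _).trans (eq_head hV' hW' j _).symm⟩
  by_cases hW'V : Nonempty (W' ⟶ V)
  · obtain ⟨j⟩ := hW'V
    exact (eq_head hV' hW' j _).trans (eq_head hV' hW' j _).symm
  · -- Two pieces outside `V` meet outside `V`, so they carry the same element of `S`.
    have heq : terminal.from (W ⨯ W') ≫ ι V s = terminal.from (W ⨯ W') ≫ ι V t := by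
      rw [Subsingleton.elim (terminal.from (W ⨯ W')) (prod.fst ≫ terminal.from W), Category.assoc,
        ← hks, Subsingleton.elim (prod.fst ≫ terminal.from W) (prod.snd ≫ terminal.from W'),
        Category.assoc, ← ht, ← Category.assoc, ← Category.assoc]
      exact congrArg (· ≫ r) (hU _ _)
    rcases eq_or_le hV' heq with rfl | hne
    · rw [ht, hι]
    · rcases hV.le_or_le _ _ hW hW' hne with h | h
      · exact (not_nonempty_iff.2 hWV h).elim
      · exact (hW'V h).elim

end skyscraper

end Skyscraper

/-! ### The point associated with a prime subterminal -/

section Point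

variable {C : Type u} [Category.{v} C] [HasFiniteLimits C] [HasColimits C]
  [HasSubobjectClassifier C] {V : C}

open skyscraper

/-- The stalk of the skyscraper with value `S` is `S`. -/
theorem existsUnique_germ_ι (hV : IsPrimeSubterminal V) {S : Type v}
    (z : (stalk V).obj (skyscraper V S)) :
    ∃! s : S, z = germ isSubterminal_of_terminal hV.isEmpty_top (ι V s) := by
  obtain ⟨U, hU, hUV, r, rfl⟩ := exists_eq_germ z
  obtain ⟨s, rfl⟩ := exists_eq_ι hV hU hUV r
  refine ⟨s, germ_comp _ _ _ _ _ _, fun t ht => ?_⟩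
  obtain ⟨T, hT, hTV, k, l, hkl⟩ := exists_of_germ_eq hV _ _ _ _ ht
  rw [← Category.assoc, Subsingleton.elim (k ≫ terminal.from U) (terminal.from T),
    Subsingleton.elim l (terminal.from T)] at hkl
  exact ((eq_or_le hV.isSubterminal hkl).resolve_right (not_nonempty_iff.2 hTV)).symm

/-- The counit at `S` of the adjunction between stalks and skyscrapers. -/
noncomputable def stalkSkyscraper (hV : IsPrimeSubterminal V) (S : Type v) :
    (stalk V).obj (skyscraper V S) ⟶ S :=
  ↾fun z => (existsUnique_germ_ι hV z).choose

theorem stalkSkyscraper_germ (hV : IsPrimeSubterminal V) {S : Type v} {U : C}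
    (hU : IsSubterminal U) (hUV : IsEmpty (U ⟶ V)) (s : S) :
    stalkSkyscraper hV S (germ hU hUV (terminal.from U ≫ ι V s)) = s := by
  refine ((existsUnique_germ_ι hV _).choose_spec.2 s ?_).symm
  exact germ_comp _ _ _ _ _ _

/-- When subterminals separate, the skyscraper with value `S` represents `A ↦ (stalk A → S)`. -/
theorem bijective_map_comp_stalkSkyscraper (hV : IsPrimeSubterminal V)
    (hsep : ObjectProperty.IsSeparating (fun U : C => IsSubterminal U)) (A : C) (S : Type v) :
    Function.Bijective fun g : A ⟶ skyscraper V S => (stalk V).map g ≫ stalkSkyscraper hV S := by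
  classical
  have hV' := hV.isSubterminal
  constructor
  · intro g g' h
    refine hsep _ _ fun U hU a => ?_
    by_cases hUV : Nonempty (U ⟶ V)
    · obtain ⟨j⟩ := hUV
      exact (eq_head hV' hU j _).trans (eq_head hV' hU j _).symm
    · rw [not_nonempty_iff] at hUV
      obtain ⟨s, hs⟩ := exists_eq_ι hV hU hUV (a ≫ g)
      obtain ⟨t, ht⟩ := exists_eq_ι hV hU hUV (a ≫ g')
      have := ConcreteCategory.congr_hom h (germ (V := V) hU hUV a)
      change stalkSkyscraper hV S ((stalk V).map g (germ hU hUV a)) =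
        stalkSkyscraper hV S ((stalk V).map g' (germ hU hUV a)) at this
      rw [stalk_map_germ, stalk_map_germ, hs, ht, stalkSkyscraper_germ,
        stalkSkyscraper_germ] at this
      rw [hs, ht, this]
  · intro φ
    obtain ⟨g, hg⟩ := exists_glue hsep
      (fun U hU a => if h : Nonempty (U ⟶ V) then h.some ≫ head V S
        else terminal.from U ≫ ι V (φ (germ hU (not_nonempty_iff.1 h) a)))
      (fun W U hW hU k a => by
        by_cases hWV : Nonempty (W ⟶ V)
        · obtain ⟨j⟩ := hWV
          exact (eq_head hV' hW j _).trans (eq_head hV' hW j _).symm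
        · have hUV : ¬ Nonempty (U ⟶ V) := fun ⟨j⟩ => hWV ⟨k ≫ j⟩
          rw [dif_neg hWV, dif_neg hUV, germ_comp hU (not_nonempty_iff.1 hUV), ← Category.assoc]
          exact congrArg (· ≫ _) (Subsingleton.elim _ _))
    refine ⟨g, ?_⟩
    ext z
    obtain ⟨U, hU, hUV, a, rfl⟩ := exists_eq_germ z
    have hag := hg U hU a
    rw [dif_neg (not_nonempty_iff.2 hUV)] at hag
    change stalkSkyscraper hV S ((stalk V).map g (germ hU hUV a)) = φ (germ hU hUV a)
    rw [stalk_map_germ, hag, stalkSkyscraper_germ]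

/-- When subterminals separate, the stalk functor at a prime subterminal `V` is the inverse image
of a point, and this point inhabits the subterminals that are not below `V`. -/
theorem exists_point (hV : IsPrimeSubterminal V)
    (hsep : ObjectProperty.IsSeparating (fun U : C => IsSubterminal U)) :
    ∃ f : GeomMorphism (Type v) C, ∀ U : C, IsSubterminal U →
      (Nonempty (f.inverse.obj U) ↔ IsEmpty (U ⟶ V)) := by
  let e (A : C) (S : Type v) : ((stalk V).obj A ⟶ S) ≃ (A ⟶ skyscraper V S) :=
    (Equiv.ofBijective _ (bijective_map_comp_stalkSkyscraper hV hsep A S)).symm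
  have he : ∀ A B S k φ, e A S ((stalk V).map k ≫ φ) = k ≫ e B S φ := fun A B S k φ => by
    rw [Equiv.symm_apply_eq]
    have : (stalk V).map (e B S φ) ≫ stalkSkyscraper hV S = φ := (e B S).symm_apply_apply φ
    simp only [Equiv.ofBijective_apply, Functor.map_comp, Category.assoc, this]
  refine ⟨⟨_, stalk V, Adjunction.adjunctionOfEquivRight e he, stalk_preservesFiniteLimits hV⟩,
    fun U hU => ⟨fun ⟨z⟩ => ?_, fun hUV => ⟨germ hU hUV (𝟙 U)⟩⟩⟩
  obtain ⟨W, hW, hWV, a, rfl⟩ := exists_eq_germ z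
  exact ⟨fun j => hWV.false (a ≫ j)⟩

end Point

/-! ### Prime subterminals and hyperconnected morphisms -/

section Prime

variable {C : Type u} [Category.{v} C]

theorem nonempty_hom_congr {A B A' B' : C} (i : A ≅ A') (j : B ≅ B') :
    Nonempty (A ⟶ B) ↔ Nonempty (A' ⟶ B') :=
  ⟨fun ⟨k⟩ => ⟨i.inv ≫ k ≫ j.hom⟩, fun ⟨k⟩ => ⟨i.hom ≫ k ≫ j.inv⟩⟩

/-- A point is generic for `V` when it inhabits exactly the subterminals that are not below `V`. -/
def GeomMorphism.IsGeneric (f : GeomMorphism (Type v) C) (V : C) : Prop :=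
  ∀ U : C, IsSubterminal U → (Nonempty (f.inverse.obj U) ↔ ¬ Nonempty (U ⟶ V))

/-- The direct image of the empty set is the largest subterminal not inhabited by the point. -/
theorem GeomMorphism.isGeneric_direct_pempty (f : GeomMorphism (Type v) C) :
    f.IsGeneric (f.direct.obj PEmpty.{v + 1}) := by
  refine fun U _ => ⟨fun ⟨t⟩ ⟨k⟩ => (((f.adj.homEquiv _ _).symm k) t).elim, fun h => ?_⟩
  by_contra hU
  exact h ⟨f.adj.homEquiv _ _ (↾fun t => (hU ⟨t⟩).elim)⟩

variable [HasFiniteLimits C]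

theorem IsPrimeSubterminal.of_iso {V W : C} (hV : IsPrimeSubterminal V) (i : V ≅ W) :
    IsPrimeSubterminal W where
  isSubterminal := isSubterminal_of_mono hV.isSubterminal i.inv
  isEmpty_top := ⟨fun k => hV.isEmpty_top.false (k ≫ i.inv)⟩
  le_or_le A B hA hB hAB := by
    rw [← nonempty_hom_congr (Iso.refl _) i] at hAB ⊢
    rw [← nonempty_hom_congr (Iso.refl B) i]
    exact hV.le_or_le A B hA hB hAB

theorem GeomMorphism.isPrimeSubterminal_direct_pempty (f : GeomMorphism (Type v) C) :
    IsPrimeSubterminal (f.direct.obj PEmpty.{v + 1}) where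
  isSubterminal Z s t := by
    apply (f.adj.homEquiv _ _).symm.injective
    ext z
    exact (((f.adj.homEquiv _ _).symm s) z).elim
  isEmpty_top := by
    have := f.lex
    rw [← not_nonempty_iff, ← f.isGeneric_direct_pempty _ isSubterminal_of_terminal]
    exact ⟨(terminalIsTerminal.isTerminalObj f.inverse (⊤_ C)).from PUnit.{v + 1} PUnit.unit⟩
  le_or_le U W hU hW hUW := by
    have := f.lex
    by_contra! h
    rw [← not_nonempty_iff, ← not_nonempty_iff, ← f.isGeneric_direct_pempty _ hU,
      ← f.isGeneric_direct_pempty _ hW] at h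
    obtain ⟨⟨a⟩, ⟨b⟩⟩ := h
    refine (f.isGeneric_direct_pempty _ (isSubterminal_prod hU hW)).1 ⟨?_⟩ hUW
    exact (PreservesLimitPair.iso f.inverse U W).inv
      (Limits.prod.lift (↾(fun _ : PUnit.{v + 1} => a)) (↾(fun _ : PUnit.{v + 1} => b)) PUnit.unit)

end Prime

namespace GeomMorphism.IsHyperconnected

variable {E : Type u} [Category.{v} E] {F : Type u₁} [Category.{v₁} F] {h : GeomMorphism E F}

theorem hasColimits (hh : h.IsHyperconnected) [HasColimitsOfSize.{v₂, v₃} E] :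
    HasColimitsOfSize.{v₂, v₃} F := by
  have := hh.full
  have := hh.faithful
  have : Coreflective h.inverse := { R := h.direct, adj := h.adj }
  exact ⟨fun _ _ => hasColimitsOfShape_of_coreflective h.inverse⟩

theorem nonempty_hom_iff (hh : h.IsHyperconnected) {U W : F} :
    Nonempty (h.inverse.obj U ⟶ h.inverse.obj W) ↔ Nonempty (U ⟶ W) := by
  have := hh.full
  exact ⟨fun ⟨k⟩ => ⟨h.inverse.preimage k⟩, fun ⟨k⟩ => ⟨h.inverse.map k⟩⟩

theorem isSubterminal_iff (hh : h.IsHyperconnected) [HasFiniteLimits F] {U : F} :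
    IsSubterminal (h.inverse.obj U) ↔ IsSubterminal U := by
  have := hh.faithful
  have := h.lex
  exact ⟨fun hU _ f g => h.inverse.map_injective (hU _ _), isSubterminal_obj h.inverse⟩

/-- Up to isomorphism, every subterminal of `E` is the inverse image of a subterminal of `F`. -/
theorem exists_iso [HasTerminal E] [HasFiniteLimits F] (hh : h.IsHyperconnected) {U : E}
    (hU : IsSubterminal U) :
    ∃ W : F, IsSubterminal W ∧ Nonempty (h.inverse.obj W ≅ U) := by
  have := hh.closed_sub
  have := h.lex
  have := hU.mono_isTerminal_from (terminalIsTerminal.isTerminalObj h.inverse (⊤_ F))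
  obtain ⟨W, ⟨i⟩⟩ := h.inverse.essImage.prop_of_mono
    ((terminalIsTerminal.isTerminalObj h.inverse (⊤_ F)).from U) (h.inverse.obj_mem_essImage _)
  exact ⟨W, hh.isSubterminal_iff.1 (isSubterminal_of_mono hU i.hom), ⟨i⟩⟩

variable [HasFiniteLimits E] [HasFiniteLimits F]

theorem isPrimeSubterminal_iff (hh : h.IsHyperconnected) {V : F} :
    IsPrimeSubterminal (h.inverse.obj V) ↔ IsPrimeSubterminal V := by
  have := h.lex
  have htop : Nonempty (⊤_ E ⟶ h.inverse.obj V) ↔ Nonempty (⊤_ F ⟶ V) := by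
    rw [← hh.nonempty_hom_iff]
    exact nonempty_hom_congr (PreservesTerminal.iso h.inverse).symm (Iso.refl _)
  refine ⟨fun hV => ⟨hh.isSubterminal_iff.1 hV.isSubterminal, ?_, fun U W hU hW hUW => ?_⟩,
    fun hV => ⟨hh.isSubterminal_iff.2 hV.isSubterminal, ?_, fun U W hU hW hUW => ?_⟩⟩
  · rw [← not_nonempty_iff, ← htop, not_nonempty_iff]
    exact hV.isEmpty_top
  · rw [← hh.nonempty_hom_iff, ← hh.nonempty_hom_iff]
    refine hV.le_or_le _ _ (hh.isSubterminal_iff.2 hU) (hh.isSubterminal_iff.2 hW) ?_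
    rw [← nonempty_hom_congr (PreservesLimitPair.iso h.inverse U W) (Iso.refl _)]
    exact hh.nonempty_hom_iff.2 hUW
  · rw [← not_nonempty_iff, htop, not_nonempty_iff]
    exact hV.isEmpty_top
  · obtain ⟨U', hU', ⟨i⟩⟩ := hh.exists_iso hU
    obtain ⟨W', hW', ⟨j⟩⟩ := hh.exists_iso hW
    rw [← nonempty_hom_congr i (Iso.refl _), ← nonempty_hom_congr j (Iso.refl _),
      hh.nonempty_hom_iff, hh.nonempty_hom_iff]
    refine hV.le_or_le _ _ hU' hW' ?_
    rw [← nonempty_hom_congr (prod.mapIso i j) (Iso.refl _),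
      ← nonempty_hom_congr (PreservesLimitPair.iso h.inverse U' W') (Iso.refl _)] at hUW
    exact hh.nonempty_hom_iff.1 hUW

end GeomMorphism.IsHyperconnected

/-! ### The subterminal topology -/

section Topology

variable {E : Type u} [Category.{v} E] [HasFiniteLimits E]

theorem le_iff_nonempty_hom {u w : Subobject (⊤_ E)} : u ≤ w ↔ Nonempty ((u : E) ⟶ (w : E)) :=
  ⟨fun h => ⟨Subobject.ofLE _ _ h⟩, fun ⟨k⟩ => Subobject.le_of_comm k (Subsingleton.elim _ _)⟩

theorem exists_subobject_iso {U : E} (hU : IsSubterminal U) :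
    ∃ u : Subobject (⊤_ E), Nonempty ((u : E) ≅ U) :=
  have := hU.mono_terminal_from
  ⟨Subobject.mk (terminal.from U), ⟨Subobject.underlyingIso _⟩⟩

theorem mem_openOf {P : Set (Point E)} {f : GeomMorphism (Type v) E}
    (hf : (⟦f⟧ : Point E) ∈ P) (u : Subobject (⊤_ E)) :
    (⟨⟦f⟧, hf⟩ : P) ∈ openOf P u ↔ Nonempty (f.inverse.obj (u : E)) :=
  inhabits_iff_nonempty f u

/-- When `P` separates subterminals, the subterminals are ordered like the corresponding open
sets. -/
theorem openOf_subset_openOf {P : Set (Point E)} (hP : SeparatesSubterminals P)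
    {u w : Subobject (⊤_ E)} : openOf P u ⊆ openOf P w ↔ u ≤ w := by
  refine ⟨fun h => ?_, openOf_mono P⟩
  by_contra hle
  have hne : IsEmpty (((u ⊓ w : Subobject (⊤_ E)) : E) ≅ (u : E)) := ⟨fun i =>
    hle ((le_iff_nonempty_hom.2 ⟨i.inv⟩).trans inf_le_right)⟩
  obtain ⟨f, hf, hfu⟩ := hP _ _ hne
  have h1 := f.subsingleton_obj (isSubterminal_subobject u)
  have h2 := f.subsingleton_obj (isSubterminal_subobject (u ⊓ w))
  have hiff : Nonempty (f.inverse.obj ((u ⊓ w : Subobject (⊤_ E)) : E)) ↔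
      Nonempty (f.inverse.obj (u : E)) := by
    rw [← mem_openOf hf, ← mem_openOf hf, openOf_inf]
    exact ⟨fun h => h.1, fun hu => ⟨hu, h hu⟩⟩
  refine hfu.false (Equiv.toIso ⟨fun a => (hiff.1 ⟨a⟩).some, fun b => (hiff.2 ⟨b⟩).some,
    fun _ => Subsingleton.elim _ _, fun _ => Subsingleton.elim _ _⟩)

/-- In terms of the lattice of subterminals, a prime subterminal is a prime element. -/
theorem isPrimeSubterminal_coe_iff {w : Subobject (⊤_ E)} :
    IsPrimeSubterminal (w : E) ↔
      w ≠ ⊤ ∧ ∀ a b : Subobject (⊤_ E), a ⊓ b ≤ w → a ≤ w ∨ b ≤ w := by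
  have htop : w ≠ ⊤ ↔ IsEmpty (⊤_ E ⟶ (w : E)) := by
    rw [← not_nonempty_iff, not_iff_not, ← top_le_iff, le_iff_nonempty_hom]
    exact nonempty_hom_congr (asIso (⊤ : Subobject (⊤_ E)).arrow) (Iso.refl _)
  have hinf : ∀ a b : Subobject (⊤_ E), a ⊓ b ≤ w ↔ Nonempty ((a : E) ⨯ (b : E) ⟶ (w : E)) := by
    intro a b
    constructor
    · intro h
      have := (isSubterminal_prod (isSubterminal_subobject a)
        (isSubterminal_subobject b)).mono_terminal_from
      have hle : Subobject.mk (terminal.from ((a : E) ⨯ (b : E))) ≤ w :=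
        (le_inf (Subobject.mk_le_of_comm prod.fst (Subsingleton.elim _ _))
          (Subobject.mk_le_of_comm prod.snd (Subsingleton.elim _ _))).trans h
      exact ⟨(Subobject.underlyingIso _).inv ≫ Subobject.ofLE _ _ hle⟩
    · rintro ⟨k⟩
      exact le_iff_nonempty_hom.2 ⟨prod.lift (Subobject.ofLE _ _ inf_le_left)
        (Subobject.ofLE _ _ inf_le_right) ≫ k⟩
  constructor
  · refine fun hV => ⟨htop.2 hV.isEmpty_top, fun a b hab => ?_⟩
    rw [le_iff_nonempty_hom, le_iff_nonempty_hom]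
    exact hV.le_or_le _ _ (isSubterminal_subobject a) (isSubterminal_subobject b)
      ((hinf a b).1 hab)
  · refine fun ⟨h1, h2⟩ => ⟨isSubterminal_subobject w, htop.1 h1, fun A B hA hB hAB => ?_⟩
    obtain ⟨a, ⟨i⟩⟩ := exists_subobject_iso hA
    obtain ⟨b, ⟨j⟩⟩ := exists_subobject_iso hB
    rw [← nonempty_hom_congr i (Iso.refl _), ← nonempty_hom_congr j (Iso.refl _),
      ← le_iff_nonempty_hom, ← le_iff_nonempty_hom]
    rw [← nonempty_hom_congr (prod.mapIso i j) (Iso.refl _)] at hAB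
    exact h2 a b ((hinf a b).2 hAB)

variable [HasSubobjectClassifier E] [HasColimits E] {P : Set (Point E)}

theorem isOpen_openOf (u : Subobject (⊤_ E)) :
    IsOpen (show Set (SubterminalSpace P) from openOf P u) := ⟨u, rfl⟩

theorem inseparable_iff {f g : GeomMorphism (Type v) E} (hf : (⟦f⟧ : Point E) ∈ P)
    (hg : (⟦g⟧ : Point E) ∈ P) :
    Inseparable (X := SubterminalSpace P) ⟨⟦f⟧, hf⟩ ⟨⟦g⟧, hg⟩ ↔
      ∀ U : E, IsSubterminal U → (Nonempty (f.inverse.obj U) ↔ Nonempty (g.inverse.obj U)) := by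
  refine inseparable_iff_forall_isOpen.trans ?_
  constructor
  · intro h U hU
    obtain ⟨u, ⟨i⟩⟩ := exists_subobject_iso hU
    rw [← (f.inverse.mapIso i).toEquiv.nonempty_congr,
      ← (g.inverse.mapIso i).toEquiv.nonempty_congr, ← mem_openOf hf, ← mem_openOf hg]
    exact h _ (isOpen_openOf u)
  · rintro h _ ⟨u, rfl⟩
    exact (mem_openOf hf u).trans
      ((h _ (isSubterminal_subobject u)).trans (mem_openOf hg u).symm)

theorem isIrreducible_compl_openOf_iff (hP : SeparatesSubterminals P) {w : Subobject (⊤_ E)} :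
    IsIrreducible (show Set (SubterminalSpace P) from (openOf P w)ᶜ) ↔
      IsPrimeSubterminal (w : E) := by
  have hmeet : ∀ a : Subobject (⊤_ E),
      ((openOf P w)ᶜ ∩ openOf P a).Nonempty ↔ ¬ a ≤ w := fun a => by
    rw [← openOf_subset_openOf hP, Set.not_subset, Set.inter_comm]
    rfl
  rw [isPrimeSubterminal_coe_iff]
  refine and_congr ?_ ⟨fun h a b hab => ?_, ?_⟩
  · rw [Ne, ← top_le_iff, ← hmeet, openOf_top, Set.inter_univ]
    rfl
  · by_contra! hcon
    refine (hmeet (a ⊓ b)).1 ?_ hab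
    rw [openOf_inf]
    exact h _ _ (isOpen_openOf a) (isOpen_openOf b) ((hmeet a).2 hcon.1) ((hmeet b).2 hcon.2)
  · rintro h _ _ ⟨a, rfl⟩ ⟨b, rfl⟩ ha hb
    have ha' := (hmeet a).1 ha
    have hb' := (hmeet b).1 hb
    have := (hmeet (a ⊓ b)).2 fun hab => (h a b hab).elim ha' hb'
    rwa [openOf_inf] at this

theorem isGenericPoint_iff (hP : SeparatesSubterminals P) {f : GeomMorphism (Type v) E}
    (hf : (⟦f⟧ : Point E) ∈ P) {w : Subobject (⊤_ E)} :
    IsGenericPoint (α := SubterminalSpace P) ⟨⟦f⟧, hf⟩ (openOf P w)ᶜ ↔ f.IsGeneric (w : E) := by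
  constructor
  · intro h U hU
    obtain ⟨u, ⟨i⟩⟩ := exists_subobject_iso hU
    rw [← (f.inverse.mapIso i).toEquiv.nonempty_congr, ← nonempty_hom_congr i (Iso.refl _),
      ← le_iff_nonempty_hom, ← openOf_subset_openOf hP, Set.not_subset, ← mem_openOf hf]
    refine (h.mem_open_set_iff (isOpen_openOf u)).trans ?_
    rw [Set.inter_comm]
    rfl
  · intro h
    refine Set.Subset.antisymm (closure_minimal ?_ (isOpen_openOf w).isClosed_compl) ?_
    · refine Set.singleton_subset_iff.2 ?_
      exact fun hw => (h _ (isSubterminal_subobject w)).1 ((mem_openOf hf w).1 hw) ⟨𝟙 _⟩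
    · intro z hz
      rw [mem_closure_iff]
      rintro _ ⟨u, rfl⟩ hzu
      refine ⟨_, (mem_openOf hf u).2 ((h _ (isSubterminal_subobject u)).2 fun hk => hz ?_), rfl⟩
      exact openOf_mono P (le_iff_nonempty_hom.2 hk) hzu

/-- The irreducible closed sets are the complements of the prime subterminals. -/
theorem quasiSober_iff (hP : SeparatesSubterminals P) :
    QuasiSober (SubterminalSpace P) ↔ ∀ V : E, IsPrimeSubterminal V →
      ∃ f : GeomMorphism (Type v) E, (⟦f⟧ : Point E) ∈ P ∧ f.IsGeneric V := by
  constructor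
  · intro h V hV
    obtain ⟨w, ⟨i⟩⟩ := exists_subobject_iso hV.isSubterminal
    obtain ⟨⟨p, hf⟩, hx⟩ := h.sober ((isIrreducible_compl_openOf_iff hP).2 (hV.of_iso i.symm))
      (isOpen_openOf w).isClosed_compl
    induction p using Quotient.inductionOn with | h f => ?_
    refine ⟨f, hf, fun U hU => ?_⟩
    rw [← nonempty_hom_congr (Iso.refl U) i]
    exact (isGenericPoint_iff hP hf).1 hx U hU
  · intro h
    refine ⟨fun {Z} hZ hZc => ?_⟩
    obtain ⟨w, hw⟩ := hZc.isOpen_compl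
    obtain rfl : Z = (openOf P w)ᶜ := by rw [← hw]; exact (compl_compl Z).symm
    obtain ⟨f, hf, hfw⟩ := h _ ((isIrreducible_compl_openOf_iff hP).1 hZ)
    exact ⟨_, (isGenericPoint_iff hP hf).2 hfw⟩

end Topology

/-! ### Sobriety -/

section Sobriety

variable {E : Type u} [Category.{v} E] [HasFiniteLimits E] {F : Type u₁} [Category.{v} F]
  [HasFiniteLimits F] {h : GeomMorphism E F}

/-- Two points become equal in `F` when they inhabit the same subterminals: the subterminals of `E`
and of `F` agree, and those of `F` determine its points. -/
theorem map_eq_map_iff (hh : h.IsHyperconnected)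
    (hsep : ObjectProperty.IsSeparating (fun U : F => IsSubterminal U))
    {f g : GeomMorphism (Type v) E} :
    Point.map h ⟦f⟧ = Point.map h ⟦g⟧ ↔
      ∀ U : E, IsSubterminal U → (Nonempty (f.inverse.obj U) ↔ Nonempty (g.inverse.obj U)) := by
  constructor
  · intro hfg U hU
    obtain ⟨e⟩ : f.comp h ≈ g.comp h := Quotient.exact hfg
    obtain ⟨W, hW, ⟨i⟩⟩ := hh.exists_iso hU
    exact ((f.inverse.mapIso i).symm ≪≫ e.app W ≪≫ g.inverse.mapIso i).toEquiv.nonempty_congr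
  · exact fun hfg => Quotient.sound (equiv_of_inhabits_iff hsep
      (f := f.comp h) (g := g.comp h) fun U hU => hfg _ (hh.isSubterminal_iff.2 hU))

theorem isSober_iff_bijective [HasSubobjectClassifier E] [HasColimits E] [HasSubobjectClassifier F]
    {P : Set (Point E)} (hP : SeparatesSubterminals P) (hh : h.IsHyperconnected)
    {l : GeomMorphism F (Type v)} (hl : l.IsLocalic) :
    IsSober (SubterminalSpace P) ↔
      Function.Bijective (fun s : P => Point.map h (s : Point E)) := by
  have hsep := hl.isSeparating
  have : HasColimits F := hh.hasColimits
  rw [IsSober, and_comm, Function.Bijective]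
  refine and_congr ⟨?_, ?_⟩ ((quasiSober_iff hP).trans ⟨?_, ?_⟩)
  · rintro hT ⟨p, hp⟩ ⟨q, hq⟩ hpq
    induction p using Quotient.inductionOn with | h f => ?_
    induction q using Quotient.inductionOn with | h g => ?_
    exact hT.t0 ((inseparable_iff hp hq).2 ((map_eq_map_iff hh hsep).1 hpq))
  · refine fun hinj => ⟨?_⟩
    rintro ⟨p, hp⟩ ⟨q, hq⟩ hpq
    induction p using Quotient.inductionOn with | h f => ?_
    induction q using Quotient.inductionOn with | h g => ?_
    exact hinj ((map_eq_map_iff hh hsep).2 ((inseparable_iff hp hq).1 hpq))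
  · intro H p
    induction p using Quotient.inductionOn with | h g => ?_
    obtain ⟨f, hf, hfV⟩ := H _ (hh.isPrimeSubterminal_iff.2 g.isPrimeSubterminal_direct_pempty)
    refine ⟨⟨_, hf⟩, Quotient.sound (equiv_of_inhabits_iff hsep fun U hU => ?_)⟩
    exact (hfV _ (hh.isSubterminal_iff.2 hU)).trans
      ((not_congr hh.nonempty_hom_iff).trans (g.isGeneric_direct_pempty U hU).symm)
  · intro hsurj V hV
    obtain ⟨V', hV', ⟨i⟩⟩ := hh.exists_iso hV.isSubterminal
    obtain ⟨g, hg⟩ := exists_point (hh.isPrimeSubterminal_iff.1 (hV.of_iso i.symm)) hsep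
    obtain ⟨⟨p, hf⟩, hfg⟩ := hsurj ⟦g⟧
    induction p using Quotient.inductionOn with | h f => ?_
    obtain ⟨e⟩ : f.comp h ≈ g := Quotient.exact hfg
    refine ⟨f, hf, fun U hU => ?_⟩
    obtain ⟨W, hW, ⟨j⟩⟩ := hh.exists_iso hU
    rw [((f.inverse.mapIso j).symm ≪≫ e.app W).toEquiv.nonempty_congr, hg W hW,
      ← nonempty_hom_congr j i, hh.nonempty_hom_iff, not_nonempty_iff]

end Sobriety

section Identity

variable (E : Type u) [Category.{v} E]

/-- The identity geometric morphism. -/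
def GeomMorphism.identity : GeomMorphism E E where
  direct := 𝟭 E
  inverse := 𝟭 E
  adj := Adjunction.id
  lex := inferInstance

theorem GeomMorphism.isHyperconnected_identity : (GeomMorphism.identity E).IsHyperconnected where
  full := inferInstanceAs (𝟭 E).Full
  faithful := inferInstanceAs (𝟭 E).Faithful
  closed_sub := ⟨fun {X _} _ _ _ => (𝟭 E).obj_mem_essImage X⟩
  closed_quot := ⟨fun {_ Y} _ _ _ => (𝟭 E).obj_mem_essImage Y⟩

theorem Point.map_identity : Point.map (GeomMorphism.identity E) = id := by
  ext p
  induction p using Quotient.inductionOn with | h f => ?_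
  exact Quotient.sound ⟨f.inverse.leftUnitor⟩

end Identity

end SubterminalSobriety

open SubterminalSobriety in
theorem theorem2p7 {E : Type u} [Category.{v} E] [IsTopos E] [HasColimits E]
    (P : Set (Point E)) (hP : SeparatesSubterminals P) :
    (∀ (F : Type u₁) [Category.{v} F] [IsTopos F]
        (γ : GeomMorphism E (Type v)) (h : GeomMorphism E F) (l : GeomMorphism F (Type v)),
        h.comp l ≈ γ → h.IsHyperconnected → l.IsLocalic →
        (IsSober (SubterminalSpace P) ↔
          Function.Bijective (fun s : P => Point.map h (s : Point E)))) ∧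
    (IsLocalicTopos E → (IsSober (SubterminalSpace P) ↔ P = Set.univ)) := by
  refine ⟨fun F _ _ γ h l _ hh hl => isSober_iff_bijective hP hh hl, fun ⟨γ, hγ⟩ => ?_⟩
  rw [isSober_iff_bijective hP (GeomMorphism.isHyperconnected_identity E) hγ, Point.map_identity]
  constructor
  · intro hb
    refine Set.eq_univ_of_forall fun p => ?_
    obtain ⟨s, rfl⟩ := hb.2 p
    exact s.2
  · rintro rfl
    exact ⟨Subtype.val_injective, fun p => ⟨⟨p, trivial⟩, rfl⟩⟩
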